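/- For points $x,y,z$ of a metric space put $(x|y)_z=\frac12\bigl(d(x,z)+d(z,y)-d(x,y)\bigr)$ (the Gromov product). The tension of a chain of points $x_0,x_1,\dots,x_n$ ($n\ge 2$) in a metric space is $$\tau(x_0,\dots,x_n)=\sum_{j=1}^{n-1}d(x_{j-1},x_{j+1})-\sum_{j=2}^{n-1}d(x_{j-1},x_j)-d(x_0,x_n).$$ A pair $(a,b)$ of non-negative real numbers is good if $\sinh(a-b)>2\sinh(a/2)$; its translation number is the unique $\lambda>1$ with $\cosh\bigl(\tfrac12\log\lambda\bigr)=\frac{\sinh(a-b)}{2\sinh(a/2)}$. For a good pair $(a,b)$, a chain $x_0,\dots,x_n$ is $(a,b)$-good if $d(x_{j+1},x_j)\ge a$ for $0\le j\le n-1$ and $(x_{j-1}|x_{j+1})_{x_j}\le b$ for $1\le j\le n-1$. A metric space is $\mathrm{CAT}(-1)$ if it is geodesic and, for every geodesic triangle with distinct vertices and all points $p,q$ on its sides, $d(p,q)\le d(\bar p,\bar q)$, where $\bar p,\bar q$ are the corresponding points of a comparison triangle (with the same side lengths) in the hyperbolic plane $\mathbb{H}^2$ of curvature $-1$. Corollary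 ($\mathrm{CAT}(-1)$ Avalanche Principle). Let $X$ be a $\mathrm{CAT}(-1)$ space, let $(a,b)$ be a good pair with translation number $\lambda$, let $n\ge 2$, and let $x_0,x_1,\dots,x_n\in X$ be an $(a,b)$-good chain. Then $$|\tau(x_0,\dots,x_n)|\le (n-2)\,\frac{2}{\lambda-1}.$$ -/

import Mathlib

section Chains

variable {X : Type*} [MetricSpace X]

/-- `γ`, restricted to `[0, dist x y]`, is a geodesic segment from `x` to `y`. -/
def IsGeodesicSegment (γ : ℝ → X) (x y : X) : Prop :=
  γ 0 = x ∧ γ (dist x y) = y ∧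
    ∀ s ∈ Set.Icc 0 (dist x y), ∀ t ∈ Set.Icc 0 (dist x y), dist (γ s) (γ t) = |s - t|

/-- Three vertices `v 0, v 1, v 2` with geodesic sides, `γ i` joining `v i` to `v (i + 1)`
(indices modulo `3`). -/
def IsGeodesicTriangle (v : Fin 3 → X) (γ : Fin 3 → ℝ → X) : Prop :=
  ∀ i, IsGeodesicSegment (γ i) (v i) (v (i + 1))

/-- The triangle with vertices `w` in the hyperbolic plane is a comparison triangle for the one
with vertices `v`. -/
def IsComparisonTriangle (v : Fin 3 → X) (w : Fin 3 → UpperHalfPlane) : Prop :=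
  ∀ i j, dist (w i) (w j) = dist (v i) (v j)

variable (X) in
/-- `CAT(-1)` spaces: geodesic spaces in which distances between points on the sides of a geodesic
triangle with distinct vertices do not exceed the distances between the corresponding points of a
comparison triangle in the hyperbolic plane.  The comparison point of `γ i s`, the point of the
`i`-th side at distance `s` from `v i`, is `δ i s`. -/
def IsCATNegOne : Prop :=
  (∀ x y : X, ∃ γ : ℝ → X, IsGeodesicSegment γ x y) ∧
  ∀ (v : Fin 3 → X) (γ : Fin 3 → ℝ → X), Function.Injective v → IsGeodesicTriangle v γ →
    ∀ (w : Fin 3 → UpperHalfPlane) (δ : Fin 3 → ℝ → UpperHalfPlane),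
      IsComparisonTriangle v w → IsGeodesicTriangle w δ →
      ∀ i j : Fin 3, ∀ s ∈ Set.Icc 0 (dist (v i) (v (i + 1))),
        ∀ t ∈ Set.Icc 0 (dist (v j) (v (j + 1))),
          dist (γ i s) (γ j t) ≤ dist (δ i s) (δ j t)

/-- The Gromov product of `x` and `y` based at `z`. -/
noncomputable def gromovProduct (x y z : X) : ℝ :=
  (dist x z + dist z y - dist x y) / 2

/-- The tension of the chain `x 0, …, x n`. -/
noncomputable def tension (n : ℕ) (x : ℕ → X) : ℝ :=
  ∑ j ∈ Finset.Icc 1 (n - 1), dist (x (j - 1)) (x (j + 1))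
    - ∑ j ∈ Finset.Icc 2 (n - 1), dist (x (j - 1)) (x j) - dist (x 0) (x n)

/-- Good pairs of real numbers. -/
def IsGoodPair (a b : ℝ) : Prop :=
  0 ≤ a ∧ 0 ≤ b ∧ 2 * Real.sinh (a / 2) < Real.sinh (a - b)

/-- The chain `x 0, …, x n` satisfies the inequalities of an `(a, b)`-good chain. -/
def IsGoodChain (a b : ℝ) (n : ℕ) (x : ℕ → X) : Prop :=
  (∀ j, j + 1 ≤ n → a ≤ dist (x (j + 1)) (x j)) ∧
  ∀ j, 1 ≤ j → j + 1 ≤ n → gromovProduct (x (j - 1)) (x (j + 1)) (x j) ≤ b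

end Chains

/-- The translation number of `(a, b)`; for a good pair it is the unique `l > 1` with
`cosh (log l / 2) = sinh (a - b) / (2 * sinh (a / 2))`, see `eq_translationNumber_iff`. -/
noncomputable def translationNumber (a b : ℝ) : ℝ :=
  Real.exp (2 * Real.arcosh (Real.sinh (a - b) / (2 * Real.sinh (a / 2))))

theorem eq_translationNumber_iff {a b : ℝ} (h : IsGoodPair a b) (l : ℝ) :
    l = translationNumber a b ↔
      1 < l ∧ Real.cosh (Real.log l / 2) = Real.sinh (a - b) / (2 * Real.sinh (a / 2)) := by
  obtain ⟨ha, hb, hab⟩ := h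
  have ha0 : 0 < a := by
    rcases ha.lt_or_eq with h | h
    · exact h
    · subst h
      have h1 : Real.sinh (0 - b) ≤ 0 := Real.sinh_nonpos_iff.2 (by linarith)
      simp only [zero_div, Real.sinh_zero, mul_zero] at hab
      linarith
  have hs : 0 < 2 * Real.sinh (a / 2) := by
    have := Real.sinh_pos_iff.2 (half_pos ha0)
    linarith
  have hc : 1 < Real.sinh (a - b) / (2 * Real.sinh (a / 2)) := (one_lt_div hs).2 hab
  unfold translationNumber
  generalize Real.sinh (a - b) / (2 * Real.sinh (a / 2)) = c at hc ⊢
  constructor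
  · rintro rfl
    refine ⟨Real.one_lt_exp_iff.2 (by linarith [Real.arcosh_pos hc]), ?_⟩
    rw [Real.log_exp, mul_div_cancel_left₀ _ two_ne_zero, Real.cosh_arcosh hc.le]
  · rintro ⟨hl, rfl⟩
    rw [Real.arcosh_cosh (by linarith [Real.log_pos hl]), mul_div_cancel₀ _ two_ne_zero,
      Real.exp_log (by linarith)]

/-! The tension telescopes into the tensions of the `n - 2` quadruples x₀, x_j, x_{j+1}, x_{j+2}
with j ≥ 1 (`tension_eq_sum`), so it is enough to bound each of these by 2/(λ - 1).

The tool is the Ptolemy inequality for f(d), with f(t) = exp(t/2) and f(t) = sinh(t/2). In the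
hyperbolic plane both cases come from Ptolemy in ℂ. They pass to CAT(-1) spaces by gluing two
comparison triangles along a diagonal, or by straightening the quadrilateral at a reflex vertex
(`IsHyperbolicPtolemaic.catNegOne`).

For exp, one of the three Ptolemy products of a quadruple is at most 1/λ times another, provided
that the distance to x₀ grows by at least log λ per step. The remaining product then agrees with
that other one up to a factor in [1 - 1/λ, 1 + 1/λ], which bounds the tension.

The growth (`IsGoodChain.dist_add_log_le`) is a comparison with the extremal chain: points on an
equidistant curve with steps a and Gromov products b, whose projections to the axis advance by log
λ. `halfTranslation` converts distances into such advances. Its convexity and the sinh inequality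
show by induction that a good chain advances at least as fast. -/

/-- A function of the distance that satisfies the Ptolemy inequality in the hyperbolic plane. -/
structure IsHyperbolicPtolemaic (f : ℝ → ℝ) : Prop where
  mono : Monotone f
  nonneg : ∀ t, 0 ≤ t → 0 ≤ f t
  ptolemy : ∀ z₁ z₂ z₃ z₄ : UpperHalfPlane,
    f (dist z₁ z₂) * f (dist z₃ z₄) ≤
      f (dist z₁ z₃) * f (dist z₂ z₄) + f (dist z₁ z₄) * f (dist z₂ z₃)

/-! ### Ptolemy inequalities in the hyperbolic plane -/

namespace UpperHalfPlane

open ComplexConjugate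

theorem ptolemy_complex (a b c d : ℂ) :
    dist a b * dist c d ≤ dist a c * dist b d + dist a d * dist b c := by
  have h := EuclideanGeometry.mul_dist_le_mul_dist_add_mul_dist a c b d
  rw [dist_comm c b] at h
  linarith

/-- Since sinh(d/2) = |z - w| / (2√(im z · im w)), this is Ptolemy in ℂ divided by a factor common
to all three products. -/
theorem sinh_half_ptolemy (z₁ z₂ z₃ z₄ : UpperHalfPlane) :
    Real.sinh (dist z₁ z₂ / 2) * Real.sinh (dist z₃ z₄ / 2) ≤
      Real.sinh (dist z₁ z₃ / 2) * Real.sinh (dist z₂ z₄ / 2) +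
        Real.sinh (dist z₁ z₄ / 2) * Real.sinh (dist z₂ z₃ / 2) := by
  have h := ptolemy_complex (z₁ : ℂ) z₂ z₃ z₄
  have h1 := Real.sqrt_pos.2 z₁.im_pos
  have h2 := Real.sqrt_pos.2 z₂.im_pos
  have h3 := Real.sqrt_pos.2 z₃.im_pos
  have h4 := Real.sqrt_pos.2 z₄.im_pos
  simp only [sinh_half_dist, Real.sqrt_mul z₁.im_pos.le, Real.sqrt_mul z₂.im_pos.le,
    Real.sqrt_mul z₃.im_pos.le]
  generalize √z₁.im = s₁ at *
  generalize √z₂.im = s₂ at *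
  generalize √z₃.im = s₃ at *
  generalize √z₄.im = s₄ at *
  field_simp
  linarith

/-- Here exp(d/2) is proportional to |z - w| + |z - w̄|, so Ptolemy in ℂ is applied to the points
and their mirror images. -/
theorem exp_half_ptolemy (z₁ z₂ z₃ z₄ : UpperHalfPlane) :
    Real.exp (dist z₁ z₂ / 2) * Real.exp (dist z₃ z₄ / 2) ≤
      Real.exp (dist z₁ z₃ / 2) * Real.exp (dist z₂ z₄ / 2) +
        Real.exp (dist z₁ z₄ / 2) * Real.exp (dist z₂ z₃ / 2) := by
  have cc : ∀ a b : ℂ, dist (conj a) (conj b) = dist a b := Complex.dist_conj_conj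
  have lc : ∀ a b : ℂ, dist (conj a) b = dist a (conj b) := Complex.dist_conj_comm
  have hle : ∀ a b : UpperHalfPlane, dist (a : ℂ) b ≤ dist (a : ℂ) (conj (b : ℂ)) := by
    intro a b
    have ha := a.im_pos
    have hb := b.im_pos
    rw [Complex.dist_eq_re_im, Complex.dist_eq_re_im]
    apply Real.sqrt_le_sqrt
    simp only [Complex.conj_re, Complex.conj_im, coe_im, coe_re]
    nlinarith
  have e0 := ptolemy_complex (z₁ : ℂ) z₂ z₃ z₄
  have e1 := ptolemy_complex (z₁ : ℂ) (conj (z₂ : ℂ)) z₃ (conj (z₄ : ℂ))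
  have e2 := ptolemy_complex (z₁ : ℂ) z₂ z₃ (conj (z₄ : ℂ))
  have e3 := ptolemy_complex (z₁ : ℂ) z₂ (conj (z₃ : ℂ)) z₄
  have e4 := ptolemy_complex (conj (z₁ : ℂ)) z₂ z₃ z₄
  have e5 := ptolemy_complex (z₁ : ℂ) (conj (z₂ : ℂ)) z₃ z₄
  simp only [cc, lc] at e0 e1 e2 e3 e4 e5
  have h13 := hle z₁ z₃
  have h24 := hle z₂ z₄
  -- The sum e0 + e1 + (e2 + e3 + e4 + e5)/2 is the goal except that |z₁ - z₃||z₂ - z₄| occurs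
  -- twice; `k` exchanges one copy for the reflected product.
  have k : dist (z₁ : ℂ) z₃ * dist (z₂ : ℂ) z₄ ≤
      dist (z₁ : ℂ) (conj (z₃ : ℂ)) * dist (z₂ : ℂ) (conj (z₄ : ℂ)) := by gcongr
  have h1 := Real.sqrt_pos.2 z₁.im_pos
  have h2 := Real.sqrt_pos.2 z₂.im_pos
  have h3 := Real.sqrt_pos.2 z₃.im_pos
  have h4 := Real.sqrt_pos.2 z₄.im_pos
  simp only [exp_half_dist, Real.sqrt_mul z₁.im_pos.le, Real.sqrt_mul z₂.im_pos.le,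
    Real.sqrt_mul z₃.im_pos.le]
  generalize √z₁.im = s₁ at *
  generalize √z₂.im = s₂ at *
  generalize √z₃.im = s₃ at *
  generalize √z₄.im = s₄ at *
  field_simp
  nlinarith

theorem isHyperbolicPtolemaic_sinh_half : IsHyperbolicPtolemaic fun t => Real.sinh (t / 2) where
  mono s t h := Real.sinh_le_sinh.2 (by linarith)
  nonneg t ht := Real.sinh_nonneg_iff.2 (by linarith)
  ptolemy := sinh_half_ptolemy

theorem isHyperbolicPtolemaic_exp_half : IsHyperbolicPtolemaic fun t => Real.exp (t / 2) where
  mono s t h := Real.exp_le_exp.2 (by linarith)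
  nonneg t _ := (Real.exp_pos _).le
  ptolemy := exp_half_ptolemy

/-! ### Geodesics and triangles in the hyperbolic plane -/

theorem eq_of_cosh_eq {s t : ℝ} (hs : 0 ≤ s) (ht : 0 ≤ t) (h : Real.cosh s = Real.cosh t) :
    s = t :=
  Real.cosh_injOn hs ht h

/-- Any two points of the hyperbolic plane are joined by a geodesic segment. -/
theorem exists_isGeodesicSegment (z w : UpperHalfPlane) :
    ∃ γ : ℝ → UpperHalfPlane, IsGeodesicSegment γ z w := by
  suffices H : ∃ (g : ℝ → UpperHalfPlane) (s t : ℝ), (∀ x y, dist (g x) (g y) = |x - y|) ∧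
      g s = z ∧ g t = w by
    obtain ⟨g, s, t, hg, rfl, rfl⟩ := H
    rcases le_total s t with h | h
    · refine ⟨fun r => g (s + r), by simp, ?_, fun x _ y _ => ?_⟩
      · simp only [hg, abs_sub_comm s t, abs_of_nonneg (sub_nonneg.2 h)]
        congr 1; ring
      · simp only [hg]
        congr 1; ring
    · refine ⟨fun r => g (s - r), by simp, ?_, fun x _ y _ => ?_⟩
      · simp only [hg, abs_of_nonneg (sub_nonneg.2 h)]
        congr 1; ring
      · simp only [hg]
        rw [abs_sub_comm x y]
        congr 1; ring
  by_cases hre : z.re = w.re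
  · refine ⟨fun y => mk ⟨z.re, Real.exp y⟩ (Real.exp_pos y), Real.log z.im, Real.log w.im,
      fun x y => ?_, ?_, ?_⟩
    · rw [(isometry_vertical_line z.re).dist_eq, Real.dist_eq]
    · ext1; apply Complex.ext <;> simp [Real.exp_log z.im_pos]
    · ext1; apply Complex.ext <;> simp [Real.exp_log w.im_pos, hre]
  -- The geodesic is the semicircle centred at `c` on the real line; (c + r tanh t, r / cosh t) has
  -- unit speed.
  · obtain ⟨c, hc⟩ : ∃ c : ℝ, (z.re - c) ^ 2 + z.im ^ 2 = (w.re - c) ^ 2 + w.im ^ 2 := by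
      refine ⟨(z.re ^ 2 + z.im ^ 2 - w.re ^ 2 - w.im ^ 2) / (2 * (z.re - w.re)), ?_⟩
      have := sub_ne_zero.2 hre
      field_simp
      ring
    set r := √((z.re - c) ^ 2 + z.im ^ 2) with hr
    have hr0 : 0 < r := Real.sqrt_pos.2 (by have := z.im_pos; positivity)
    have hr2 : r ^ 2 = (z.re - c) ^ 2 + z.im ^ 2 := Real.sq_sqrt (by positivity)
    have key : ∀ p : UpperHalfPlane, r ^ 2 = (p.re - c) ^ 2 + p.im ^ 2 →
        mk ⟨c + r * (Real.sinh (Real.arsinh ((p.re - c) / p.im)) /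
          Real.cosh (Real.arsinh ((p.re - c) / p.im))),
          r / Real.cosh (Real.arsinh ((p.re - c) / p.im))⟩
          (div_pos hr0 (Real.cosh_pos _)) = p := by
      intro p hp
      have hp0 := p.im_pos
      have h1 : Real.cosh (Real.arsinh ((p.re - c) / p.im)) = r / p.im := by
        rw [Real.cosh_arsinh, ← Real.sqrt_sq (div_pos hr0 hp0).le, div_pow, div_pow, hp]
        congr 1
        field_simp
        ring
      ext1
      apply Complex.ext
      · simp only [h1, Real.sinh_arsinh, coe_re]
        field_simp
        simp
      · simp only [h1, coe_im]
        field_simp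
    refine ⟨fun t => mk ⟨c + r * (Real.sinh t / Real.cosh t), r / Real.cosh t⟩
      (div_pos hr0 (Real.cosh_pos _)), _, _, fun x y => ?_, key z hr2, key w (hr2.trans hc)⟩
    apply eq_of_cosh_eq dist_nonneg (abs_nonneg _)
    rw [Real.cosh_abs, Real.cosh_sub, cosh_dist']
    have hx := Real.cosh_pos x
    have hy := Real.cosh_pos y
    have hx2 := Real.cosh_sq x
    have hy2 := Real.cosh_sq y
    simp only [mk_re, mk_im]
    field_simp
    linear_combination (-(r ^ 2 * Real.cosh x ^ 2)) * hy2 - (r ^ 2 * Real.cosh y ^ 2) * hx2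

/-- The point with coordinates `u` and `v`. -/
noncomputable def point (u v : ℝ) (hv : 0 < v) : UpperHalfPlane := mk ⟨u, v⟩ hv

/-- The unit speed parametrization of the imaginary axis. -/
noncomputable def axis (s : ℝ) : UpperHalfPlane := point 0 (Real.exp s) (Real.exp_pos s)

theorem cosh_dist_point_axis (u v : ℝ) (hv : 0 < v) (s : ℝ) :
    Real.cosh (dist (point u v hv) (axis s)) =
      (u ^ 2 + v ^ 2 + Real.exp s ^ 2) / (2 * v * Real.exp s) := by
  rw [cosh_dist']
  simp [point, axis]

theorem dist_axis (s t : ℝ) : dist (axis s) (axis t) = |s - t| := by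
  rw [← Real.dist_eq]
  exact (isometry_vertical_line 0).dist_eq s t

/-- A triangle of the hyperbolic plane with prescribed side lengths, one side lying on the
imaginary axis. -/
theorem exists_point_of_dist {l p q : ℝ} (hl : 0 < l) (hp : 0 ≤ p) (hq : 0 ≤ q)
    (hpq : p ≤ q + l) (hqp : q ≤ p + l) (hlpq : l ≤ p + q) :
    ∃ u v : ℝ, 0 ≤ u ∧ 0 < v ∧ Real.cosh p = (u ^ 2 + v ^ 2 + 1) / (2 * v) ∧
      Real.cosh q = (u ^ 2 + v ^ 2 + Real.exp l ^ 2) / (2 * v * Real.exp l) := by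
  have hE := Real.exp_pos l
  have hS := Real.sinh_pos_iff.2 hl
  have hden : 0 < Real.cosh q * Real.exp l - Real.cosh p := by
    have h1 : Real.cosh p ≤ Real.cosh (q + l) :=
      Real.cosh_le_cosh.2 (by rw [abs_of_nonneg hp, abs_of_nonneg (by linarith)]; exact hpq)
    rw [Real.cosh_add] at h1
    have h2 : Real.sinh q < Real.cosh q := Real.sinh_lt_cosh q
    rw [← Real.cosh_add_sinh l]
    nlinarith
  -- By the law of cosines this says that the cosine of the angle between the sides `l` and `p` lies
  -- in [-1, 1].
  have hgram : (Real.cosh q - Real.cosh l * Real.cosh p) ^ 2 ≤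
      (Real.sinh l * Real.sinh p) ^ 2 := by
    have h1 : Real.cosh q ≤ Real.cosh (p + l) :=
      Real.cosh_le_cosh.2 (by rw [abs_of_nonneg hq, abs_of_nonneg (by linarith)]; exact hqp)
    have h2 : Real.cosh (p - l) ≤ Real.cosh q :=
      Real.cosh_le_cosh.2 (by rw [abs_of_nonneg hq, abs_le]; constructor <;> linarith)
    rw [Real.cosh_add] at h1
    rw [Real.cosh_sub] at h2
    apply sq_le_sq'
    · linarith
    · linarith
  set E := Real.exp l with hEdef
  -- Eliminating u² + v² from the two required equations determines `v`; the first then gives u² =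
  -- 2v cosh p - 1 - v².
  set v := Real.sinh l * E / (Real.cosh q * E - Real.cosh p) with hv
  have hv0 : 0 < v := by positivity
  have hvd : v * (Real.cosh q * E - Real.cosh p) = Real.sinh l * E := by
    rw [hv, div_mul_cancel₀ _ hden.ne']
  have hSE : 2 * Real.sinh l * E = E ^ 2 - 1 := by
    rw [Real.sinh_eq, Real.exp_neg, ← hEdef]; field_simp
  have hCE : 2 * Real.cosh l * E = E ^ 2 + 1 := by
    rw [Real.cosh_eq, Real.exp_neg, ← hEdef]; field_simp
  have hu : 0 ≤ 2 * v * Real.cosh p - 1 - v ^ 2 := by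
    have hp2 := Real.sinh_sq p
    have hl2 := Real.sinh_sq l
    have hd2 : 0 < (Real.cosh q * E - Real.cosh p) ^ 2 := by positivity
    refine nonneg_of_mul_nonneg_left ?_ hd2
    have : (2 * v * Real.cosh p - 1 - v ^ 2) * (Real.cosh q * E - Real.cosh p) ^ 2 =
        E ^ 2 * ((Real.sinh l * Real.sinh p) ^ 2 -
          (Real.cosh q - Real.cosh l * Real.cosh p) ^ 2) := by
      rw [mul_pow, hp2, hl2]
      have : (2 * v * Real.cosh p - 1 - v ^ 2) * (Real.cosh q * E - Real.cosh p) ^ 2 =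
        2 * Real.cosh p * (v * (Real.cosh q * E - Real.cosh p)) * (Real.cosh q * E - Real.cosh p)
         - (Real.cosh q * E - Real.cosh p) ^ 2 - (v * (Real.cosh q * E - Real.cosh p)) ^ 2 := by
        ring
      rw [this, hvd, mul_pow, hl2]
      linear_combination (Real.cosh p) * (Real.cosh q * E - Real.cosh p) * hSE
        + (-(Real.cosh p * Real.cosh q * E)) * hCE
    rw [this]
    have : 0 ≤ E ^ 2 := by positivity
    exact mul_nonneg this (by linarith)
  refine ⟨√(2 * v * Real.cosh p - 1 - v ^ 2), v, Real.sqrt_nonneg _, hv0, ?_, ?_⟩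
  · rw [Real.sq_sqrt hu]
    field_simp
    ring
  · rw [Real.sq_sqrt hu]
    field_simp
    linear_combination 2 * hvd + hSE

end UpperHalfPlane

/-! ### The Ptolemy inequality in CAT(-1) spaces -/

section Ptolemy

open UpperHalfPlane

variable {X : Type*} [MetricSpace X]

/-- Comparison for the distance from a vertex of a triangle to a point of the opposite side, when
the comparison triangle has that side on the imaginary axis. -/
theorem IsCATNegOne.dist_le_dist_axis (hX : IsCATNegOne X) {x₁ x₂ y : X} {γ : ℝ → X}
    (hγ : IsGeodesicSegment γ x₁ x₂) {P : UpperHalfPlane} (h₁ : dist P (axis 0) = dist x₁ y)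
    (h₂ : dist P (axis (dist x₁ x₂)) = dist x₂ y) {s : ℝ} (hs : s ∈ Set.Icc 0 (dist x₁ x₂)) :
    dist y (γ s) ≤ dist P (axis s) := by
  have hd : (0 : ℝ) ≤ dist x₁ x₂ := dist_nonneg
  obtain ⟨hγ0, hγ1, hγd⟩ := id hγ
  -- Comparison is available for distinct vertices only, so coincidences are settled directly.
  by_cases h12 : x₁ = x₂
  · subst h12
    rw [dist_self] at hs
    obtain rfl : s = 0 := le_antisymm hs.2 hs.1
    rw [h₁, hγ0, dist_comm]
  by_cases hy1 : y = x₁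
  · subst hy1
    rw [dist_self, dist_eq_zero] at h₁
    rw [h₁, dist_axis, ← hγd 0 ⟨le_rfl, hd⟩ s hs, hγ0]
  by_cases hy2 : y = x₂
  · subst hy2
    rw [dist_self, dist_eq_zero] at h₂
    rw [h₂, dist_axis, ← hγd _ ⟨hd, le_rfl⟩ s hs, hγ1]
  obtain ⟨γ₁, hγ₁⟩ := hX.1 x₂ y
  obtain ⟨γ₂, hγ₂⟩ := hX.1 y x₁
  obtain ⟨δ₁, hδ₁⟩ := exists_isGeodesicSegment (axis (dist x₁ x₂)) P
  obtain ⟨δ₂, hδ₂⟩ := exists_isGeodesicSegment P (axis 0)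
  have hax : dist (axis 0) (axis (dist x₁ x₂)) = dist x₁ x₂ := by
    rw [dist_axis, zero_sub, abs_neg, abs_of_nonneg hd]
  have hδ₀ : IsGeodesicSegment axis (axis 0) (axis (dist x₁ x₂)) :=
    ⟨rfl, by rw [hax], fun s _ t _ => dist_axis s t⟩
  have hinj : Function.Injective ![x₁, x₂, y] := by
    intro i j hij
    fin_cases i <;> fin_cases j
    exacts [rfl, (h12 hij).elim, (hy1 hij.symm).elim, (h12 hij.symm).elim, rfl,
      (hy2 hij.symm).elim, (hy1 hij).elim, (hy2 hij).elim, rfl]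
  have h := hX.2 ![x₁, x₂, y] ![γ, γ₁, γ₂] hinj
    (by intro i; fin_cases i; exacts [hγ, hγ₁, hγ₂])
    ![axis 0, axis (dist x₁ x₂), P] ![axis, δ₁, δ₂]
    (by
      have flip : ∀ {p q : UpperHalfPlane} {a b : X}, dist p q = dist a b →
          dist q p = dist b a := fun h => by rw [dist_comm, h, dist_comm]
      have self : ∀ (p : UpperHalfPlane) (a : X), dist p p = dist a a := fun p a => by simp
      have h₁' : dist (axis 0) P = dist x₁ y := by rw [dist_comm, h₁]
      have h₂' : dist (axis (dist x₁ x₂)) P = dist x₂ y := by rw [dist_comm, h₂]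
      intro i j
      fin_cases i <;> fin_cases j
      exacts [self _ _, hax, h₁', flip hax, self _ _, h₂', flip h₁', flip h₂', self _ _])
    (by intro i; fin_cases i; exacts [hδ₀, hδ₁, hδ₂])
    2 0 0 ⟨le_rfl, dist_nonneg⟩ s hs
  have h' : dist (γ₂ 0) (γ s) ≤ dist (δ₂ 0) (axis s) := h
  rwa [hγ₂.1, hδ₂.1] at h'

/-- The Ptolemy inequality when the broken geodesic from `y₁` through `x₁` to `y₂` bends away
from `x₂`. -/
theorem IsHyperbolicPtolemaic.of_reflex {f : ℝ → ℝ} (hf : IsHyperbolicPtolemaic f)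
    (x₁ x₂ y₁ y₂ : X)
    (h : Real.sinh (dist x₁ y₁ + dist x₁ y₂) * Real.cosh (dist x₁ x₂) ≤
      Real.sinh (dist x₁ y₂) * Real.cosh (dist x₂ y₁) +
        Real.sinh (dist x₁ y₁) * Real.cosh (dist x₂ y₂)) :
    f (dist x₁ x₂) * f (dist y₁ y₂) ≤
      f (dist x₁ y₁) * f (dist x₂ y₂) + f (dist x₁ y₂) * f (dist x₂ y₁) := by
  have fn : ∀ a b : X, 0 ≤ f (dist a b) := fun a b => hf.nonneg _ dist_nonneg
  rcases (dist_nonneg : 0 ≤ dist x₁ y₁).eq_or_lt with hp | hp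
  · obtain rfl := dist_eq_zero.1 hp.symm
    rw [dist_comm x₂ x₁]
    have := mul_nonneg (fn x₁ x₁) (fn x₂ y₂)
    linarith
  -- In the model, y₁, x₁, y₂ are straightened onto the axis in this order, and (u, v) stands for
  -- x₂.
  obtain ⟨u, v, -, hv, h1, h2⟩ := exists_point_of_dist hp (dist_nonneg : 0 ≤ dist x₂ y₁)
    (dist_nonneg : 0 ≤ dist x₁ x₂) (by rw [dist_comm x₁ x₂]; exact dist_triangle _ _ _)
    (by have := dist_triangle_right x₁ x₂ y₁; linarith) (by
      have := dist_triangle x₁ x₂ y₁; linarith)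
  have key := hf.ptolemy (axis (dist x₁ y₁)) (point u v hv) (axis 0)
    (axis (dist x₁ y₁ + dist x₁ y₂))
  have e0 : dist (point u v hv) (axis 0) = dist x₂ y₁ := by
    apply eq_of_cosh_eq dist_nonneg dist_nonneg
    rw [cosh_dist_point_axis, h1]
    simp
  have e1 : dist (point u v hv) (axis (dist x₁ y₁)) = dist x₁ x₂ := by
    apply eq_of_cosh_eq dist_nonneg dist_nonneg
    rw [cosh_dist_point_axis, h2]
  -- By Stewart's theorem `h` would be an equality for the straightened y₂.
  have e2 : dist (point u v hv) (axis (dist x₁ y₁ + dist x₁ y₂)) ≤ dist x₂ y₂ := by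
    have : Real.cosh (dist (point u v hv) (axis (dist x₁ y₁ + dist x₁ y₂))) ≤
        Real.cosh (dist x₂ y₂) := by
      rw [cosh_dist_point_axis]
      rw [h1, h2] at h
      refine le_of_mul_le_mul_left ?_ (Real.sinh_pos_iff.2 hp)
      refine le_trans (le_of_eq ?_) (sub_le_iff_le_add'.2 h)
      simp only [Real.sinh_eq, Real.exp_add, Real.exp_neg, neg_add]
      have := Real.exp_pos (dist x₁ y₁)
      have := Real.exp_pos (dist x₁ y₂)
      field_simp
      ring
    rwa [Real.cosh_le_cosh, abs_of_nonneg dist_nonneg, abs_of_nonneg dist_nonneg] at this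
  have p2 : (0 : ℝ) ≤ dist x₁ y₂ := dist_nonneg
  rw [dist_comm _ (point u v hv), e1, e0, dist_axis, dist_axis, dist_axis, zero_sub, abs_neg,
    sub_zero, abs_of_pos hp, abs_of_nonneg (by linarith : 0 ≤ dist x₁ y₁ + dist x₁ y₂),
    sub_add_cancel_left, abs_neg, abs_of_nonneg p2] at key
  have hm : f (dist y₁ y₂) ≤ f (dist x₁ y₁ + dist x₁ y₂) := hf.mono (dist_triangle_left _ _ _)
  have hq := hf.mono e2
  calc _ ≤ f (dist x₁ x₂) * f (dist x₁ y₁ + dist x₁ y₂) := mul_le_mul_of_nonneg_left hm (fn _ _)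
    _ ≤ _ := key
    _ ≤ _ := by
      have := mul_le_mul_of_nonneg_left hq (fn x₁ y₁)
      linarith

/-- Points `-u₁ + v₁ i` and `u₂ + v₂ i` on opposite sides of the imaginary axis, and a point of
the axis collinear with them. -/
theorem dist_add_dist_le_of_crossing {u₁ v₁ u₂ v₂ s : ℝ} (hv₁ : 0 < v₁) (hv₂ : 0 < v₂)
    (hu₁ : 0 ≤ u₁) (hu₂ : 0 ≤ u₂)
    (hs : (u₁ ^ 2 + v₁ ^ 2 - Real.exp s ^ 2) * u₂ + (u₂ ^ 2 + v₂ ^ 2 - Real.exp s ^ 2) * u₁ = 0)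
    (hs' : (u₁ ^ 2 + v₁ ^ 2 - Real.exp s ^ 2) * (u₂ ^ 2 + v₂ ^ 2 - Real.exp s ^ 2) ≤ 0) :
    dist (point (-u₁) v₁ hv₁) (axis s) + dist (point u₂ v₂ hv₂) (axis s) ≤
      dist (point (-u₁) v₁ hv₁) (point u₂ v₂ hv₂) := by
  set A := dist (point (-u₁) v₁ hv₁) (axis s) with hA
  set B := dist (point u₂ v₂ hv₂) (axis s) with hB
  have hA0 : 0 ≤ A := dist_nonneg
  have hB0 : 0 ≤ B := dist_nonneg
  have cA := cosh_dist_point_axis (-u₁) v₁ hv₁ s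
  have cB := cosh_dist_point_axis u₂ v₂ hv₂ s
  rw [← hA, neg_sq] at cA
  rw [← hB] at cB
  have hh := Real.exp_pos s
  set h := Real.exp s
  have sA : (Real.sinh A) ^ 2 =
      ((u₁ ^ 2 + v₁ ^ 2 - h ^ 2) ^ 2 + 4 * u₁ ^ 2 * h ^ 2) / (2 * v₁ * h) ^ 2 := by
    rw [Real.sinh_sq, cA]; field_simp; ring
  have sB : (Real.sinh B) ^ 2 =
      ((u₂ ^ 2 + v₂ ^ 2 - h ^ 2) ^ 2 + 4 * u₂ ^ 2 * h ^ 2) / (2 * v₂ * h) ^ 2 := by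
    rw [Real.sinh_sq, cB]; field_simp; ring
  have hsinh : Real.sinh A * Real.sinh B ≤ (4 * u₁ * u₂ * h ^ 2 -
      (u₁ ^ 2 + v₁ ^ 2 - h ^ 2) * (u₂ ^ 2 + v₂ ^ 2 - h ^ 2)) / (4 * v₁ * v₂ * h ^ 2) := by
    -- The two squares agree by `hs`. The sign comes from `hs'`, which adds information only when
    -- both points lie on the axis.
    refine abs_le_of_sq_le_sq' (le_of_eq ?_) ?_ |>.2
    · rw [mul_pow, sA, sB, div_pow, div_mul_div_comm]
      have e : (2 * v₁ * h) ^ 2 * (2 * v₂ * h) ^ 2 = (4 * v₁ * v₂ * h ^ 2) ^ 2 := by ring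
      rw [e]
      congr 1
      linear_combination 4 * h ^ 2 * ((u₁ ^ 2 + v₁ ^ 2 - h ^ 2) * u₂ +
        (u₂ ^ 2 + v₂ ^ 2 - h ^ 2) * u₁) * hs
    · have : 0 ≤ 4 * u₁ * u₂ * h ^ 2 := by positivity
      apply div_nonneg _ (by positivity)
      linarith
  have : Real.cosh (A + B) ≤ Real.cosh (dist (point (-u₁) v₁ hv₁) (point u₂ v₂ hv₂)) := by
    rw [Real.cosh_add, cA, cB, cosh_dist']
    refine (add_le_add_right hsinh _).trans (le_of_eq ?_)
    simp only [point, mk_re, mk_im]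
    field_simp
    ring
  rwa [Real.cosh_le_cosh, abs_of_nonneg (by linarith), abs_of_nonneg dist_nonneg] at this

/-- Read a = σ cos θ and u = σ sin θ: with θ₁ ≤ π/2 ≤ θ₂, both sin(θ₁ + θ₂) ≤ 0 and cos θ₁ + cos θ₂
≤ 0 express θ₁ + θ₂ ≥ π. -/
theorem mul_add_mul_nonpos_of_sq_eq {a₁ a₂ u₁ u₂ σ₁ σ₂ : ℝ} (hu₂ : 0 ≤ u₂)
    (hσ₁ : 0 ≤ σ₁) (h₁ : σ₁ ^ 2 = a₁ ^ 2 + u₁ ^ 2) (h₂ : σ₂ ^ 2 = a₂ ^ 2 + u₂ ^ 2)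
    (ha₁ : 0 ≤ a₁) (ha₂ : a₂ ≤ 0) (h : a₁ * u₂ + a₂ * u₁ ≤ 0) : σ₁ * a₂ + σ₂ * a₁ ≤ 0 := by
  have h0 : (a₁ * u₂) ^ 2 ≤ (-a₂ * u₁) ^ 2 :=
    pow_le_pow_left₀ (mul_nonneg ha₁ hu₂) (by linarith) 2
  have h3 : (σ₂ * a₁) ^ 2 ≤ (σ₁ * -a₂) ^ 2 := by
    rw [mul_pow, mul_pow, h₁, h₂]
    nlinarith
  have := (abs_le_of_sq_le_sq' h3 (mul_nonneg hσ₁ (by linarith))).2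
  linarith

/-- In the same notation, cos θ₁ + cos θ₂ > 0 forces θ₁ + θ₂ < π. If both sines vanish, both angles
are 0. -/
theorem pos_or_of_not_reflex {a₁ a₂ u₁ u₂ σ₁ σ₂ : ℝ} (hu₁ : 0 ≤ u₁) (hu₂ : 0 ≤ u₂)
    (hσ₁ : 0 ≤ σ₁) (hσ₂ : 0 ≤ σ₂) (h₁ : σ₁ ^ 2 = a₁ ^ 2 + u₁ ^ 2) (h₂ : σ₂ ^ 2 = a₂ ^ 2 + u₂ ^ 2)
    (h : 0 < σ₁ * a₂ + σ₂ * a₁) :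
    0 ≤ a₁ * u₂ + a₂ * u₁ ∧ (u₁ + u₂ = 0 → 0 ≤ a₁) := by
  constructor
  · by_contra! hn
    rcases le_total 0 a₁ with h1 | h1 <;> rcases le_total 0 a₂ with h2 | h2
    · have := mul_nonneg h1 hu₂
      have := mul_nonneg h2 hu₁
      linarith
    · linarith [mul_add_mul_nonpos_of_sq_eq hu₂ hσ₁ h₁ h₂ h1 h2 hn.le]
    · linarith [mul_add_mul_nonpos_of_sq_eq hu₁ hσ₂ h₂ h₁ h2 h1 (by linarith)]
    · have := mul_nonneg hσ₁ (neg_nonneg.2 h2)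
      have := mul_nonneg hσ₂ (neg_nonneg.2 h1)
      linarith
  · intro hu
    obtain rfl : u₁ = 0 := by linarith
    obtain rfl : u₂ = 0 := by linarith
    by_contra! hn
    rcases le_total 0 a₂ with h2 | h2
    · linarith [mul_add_mul_nonpos_of_sq_eq le_rfl hσ₂ h₂ h₁ h2 hn.le (by simp)]
    · have := mul_nonneg hσ₁ (neg_nonneg.2 h2)
      have := mul_nonneg hσ₂ (neg_nonneg.2 hn.le)
      linarith

/-- The Ptolemy inequality in `CAT(-1)` spaces. -/
theorem IsHyperbolicPtolemaic.catNegOne {f : ℝ → ℝ} (hf : IsHyperbolicPtolemaic f)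
    (hX : IsCATNegOne X) (x₁ x₂ y₁ y₂ : X) :
    f (dist x₁ x₂) * f (dist y₁ y₂) ≤
      f (dist x₁ y₁) * f (dist x₂ y₂) + f (dist x₁ y₂) * f (dist x₂ y₁) := by
  by_cases hr₁ : Real.sinh (dist x₁ y₁ + dist x₁ y₂) * Real.cosh (dist x₁ x₂) ≤
      Real.sinh (dist x₁ y₂) * Real.cosh (dist x₂ y₁) +
        Real.sinh (dist x₁ y₁) * Real.cosh (dist x₂ y₂)
  · exact hf.of_reflex _ _ _ _ hr₁
  by_cases hr₂ : Real.sinh (dist x₂ y₁ + dist x₂ y₂) * Real.cosh (dist x₂ x₁) ≤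
      Real.sinh (dist x₂ y₂) * Real.cosh (dist x₁ y₁) +
        Real.sinh (dist x₂ y₁) * Real.cosh (dist x₁ y₂)
  · have := hf.of_reflex _ _ _ _ hr₂
    rw [dist_comm x₂ x₁] at this
    linarith
  rw [not_le] at hr₁ hr₂
  have hL : 0 < dist x₁ x₂ := by
    refine dist_pos.2 fun h => ?_
    subst h
    rw [dist_self, Real.cosh_zero, mul_one, Real.sinh_add] at hr₁
    linarith
  have ex := fun y : X => exists_point_of_dist hL (dist_nonneg : 0 ≤ dist x₁ y)
    (dist_nonneg : 0 ≤ dist x₂ y) (by have := dist_triangle x₁ x₂ y; linarith)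
    (by have := dist_triangle_left x₂ y x₁; linarith)
    (dist_triangle_right _ _ _)
  obtain ⟨u₁, v₁, hu₁, hv₁, hp₁, hq₁⟩ := ex y₁
  obtain ⟨u₂, v₂, hu₂, hv₂, hp₂, hq₂⟩ := ex y₂
  have hE := Real.exp_pos (dist x₁ x₂)
  have hS : 0 < Real.sinh (dist x₁ x₂) := Real.sinh_pos_iff.2 hL
  have hC : Real.cosh (dist x₁ x₂) =
      (Real.exp (dist x₁ x₂) ^ 2 + 1) / (2 * Real.exp (dist x₁ x₂)) := by
    rw [Real.cosh_eq, Real.exp_neg]; field_simp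
  have hS' : Real.sinh (dist x₁ x₂) =
      (Real.exp (dist x₁ x₂) ^ 2 - 1) / (2 * Real.exp (dist x₁ x₂)) := by
    rw [Real.sinh_eq, Real.exp_neg]; field_simp
  set E := Real.exp (dist x₁ x₂)
  have coef : ∀ {p q u v : ℝ}, 0 < v → Real.cosh p = (u ^ 2 + v ^ 2 + 1) / (2 * v) →
      Real.cosh q = (u ^ 2 + v ^ 2 + E ^ 2) / (2 * v * E) →
      v * (Real.cosh p * Real.cosh (dist x₁ x₂) - Real.cosh q) =
        Real.sinh (dist x₁ x₂) * ((u ^ 2 + v ^ 2 - 1) / 2) := by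
    intro p q u v hv hp hq
    rw [hp, hq, hC, hS']
    field_simp
    ring
  have coef' : ∀ {p q u v : ℝ}, 0 < v → Real.cosh p = (u ^ 2 + v ^ 2 + 1) / (2 * v) →
      Real.cosh q = (u ^ 2 + v ^ 2 + E ^ 2) / (2 * v * E) →
      v * (Real.cosh q * Real.cosh (dist x₁ x₂) - Real.cosh p) =
        Real.sinh (dist x₁ x₂) * ((E ^ 2 - (u ^ 2 + v ^ 2)) / (2 * E)) := by
    intro p q u v hv hp hq
    rw [hp, hq, hC, hS']
    field_simp
    ring
  have sq_sinh_left : ∀ {p u v : ℝ}, 0 < v → Real.cosh p = (u ^ 2 + v ^ 2 + 1) / (2 * v) →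
      (v * Real.sinh p) ^ 2 = ((u ^ 2 + v ^ 2 - 1) / 2) ^ 2 + u ^ 2 := by
    intro p u v hv h
    rw [mul_pow, Real.sinh_sq, h]
    field_simp
    ring
  have sq_sinh_right : ∀ {q u v E : ℝ}, 0 < v → 0 < E →
      Real.cosh q = (u ^ 2 + v ^ 2 + E ^ 2) / (2 * v * E) →
      (v * Real.sinh q) ^ 2 = ((E ^ 2 - (u ^ 2 + v ^ 2)) / (2 * E)) ^ 2 + u ^ 2 := by
    intro q u v E hv hE h
    rw [mul_pow, Real.sinh_sq, h]
    field_simp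
    ring
  have sn : ∀ {a b : X} {v : ℝ}, 0 < v → 0 ≤ v * Real.sinh (dist a b) := fun hv =>
    mul_nonneg hv.le (Real.sinh_nonneg_iff.2 dist_nonneg)
  -- For the comparison angles θᵢ at x₁, vᵢ sinh d(x₁, yᵢ) plays σᵢ, and by the law of cosines `hr₁`
  -- says cos θ₁ + cos θ₂ > 0.
  obtain ⟨A, A'⟩ := pos_or_of_not_reflex hu₁ hu₂ (sn hv₁) (sn hv₂) (sq_sinh_left hv₁ hp₁)
    (sq_sinh_left hv₂ hp₂) (by
      have := mul_pos (mul_pos hv₁ hv₂) (sub_pos.2 hr₁)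
      refine pos_of_mul_pos_right (a := Real.sinh (dist x₁ x₂)) (this.trans_eq ?_) hS.le
      rw [Real.sinh_add]
      linear_combination v₁ * Real.sinh (dist x₁ y₁) * coef hv₂ hp₂ hq₂
        + v₂ * Real.sinh (dist x₁ y₂) * coef hv₁ hp₁ hq₁)
  obtain ⟨B, B'⟩ := pos_or_of_not_reflex hu₁ hu₂ (sn hv₁) (sn hv₂) (sq_sinh_right hv₁ hE hq₁)
    (sq_sinh_right hv₂ hE hq₂) (by
      have := mul_pos (mul_pos hv₁ hv₂) (sub_pos.2 hr₂)
      refine pos_of_mul_pos_right (a := Real.sinh (dist x₁ x₂)) (this.trans_eq ?_) hS.le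
      rw [Real.sinh_add, dist_comm x₂ x₁]
      linear_combination v₁ * Real.sinh (dist x₂ y₁) * coef' hv₂ hp₂ hq₂
        + v₂ * Real.sinh (dist x₂ y₂) * coef' hv₁ hp₁ hq₁)
  obtain ⟨s, hs0, hsL, hs, hs'⟩ : ∃ s, 0 ≤ s ∧ s ≤ dist x₁ x₂ ∧
      (u₁ ^ 2 + v₁ ^ 2 - Real.exp s ^ 2) * u₂ + (u₂ ^ 2 + v₂ ^ 2 - Real.exp s ^ 2) * u₁ = 0 ∧
      (u₁ ^ 2 + v₁ ^ 2 - Real.exp s ^ 2) * (u₂ ^ 2 + v₂ ^ 2 - Real.exp s ^ 2) ≤ 0 := by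
    -- `H` is the squared height at which the other diagonal crosses the axis. The angle conditions
    -- at x₁ and x₂ place the crossing between them.
    suffices ∃ H : ℝ, 1 ≤ H ∧ H ≤ Real.exp (dist x₁ x₂) ^ 2 ∧
      (u₁ ^ 2 + v₁ ^ 2 - H) * u₂ + (u₂ ^ 2 + v₂ ^ 2 - H) * u₁ = 0 ∧
      (u₁ ^ 2 + v₁ ^ 2 - H) * (u₂ ^ 2 + v₂ ^ 2 - H) ≤ 0 by
      obtain ⟨H, h1, h2, h3, h4⟩ := this
      have h0 : 0 < H := by linarith
      have hH : Real.exp (Real.log H / 2) ^ 2 = H := by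
        rw [← Real.exp_nat_mul]
        push_cast
        rw [mul_div_cancel₀ _ two_ne_zero, Real.exp_log h0]
      refine ⟨Real.log H / 2, by have := Real.log_nonneg h1; linarith, ?_, ?_, ?_⟩
      · have := Real.log_le_log h0 h2
        rw [Real.log_pow, Real.log_exp] at this
        push_cast at this
        linarith
      · rw [hH]; exact h3
      · rw [hH]; exact h4
    -- If both points lie on the axis, the linear equation for `H` is void and the first point
    -- serves as the crossing.
    rcases (add_nonneg hu₁ hu₂).eq_or_lt with hu | hu
    · have e1 : u₁ = 0 := by linarith
      have e2 : u₂ = 0 := by linarith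
      have hB := B' hu.symm
      rw [le_div_iff₀ (by positivity)] at hB
      refine ⟨u₁ ^ 2 + v₁ ^ 2, by linarith [A' hu.symm], by linarith, ?_, by simp⟩
      rw [e1, e2]
      ring
    · refine ⟨((u₁ ^ 2 + v₁ ^ 2) * u₂ + (u₂ ^ 2 + v₂ ^ 2) * u₁) / (u₁ + u₂), ?_, ?_, ?_, ?_⟩
      · rw [le_div_iff₀ hu]
        linarith
      · rw [div_le_iff₀ hu]
        rw [div_mul_eq_mul_div, div_mul_eq_mul_div, ← add_div, le_div_iff₀ (by positivity)] at B
        linarith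
      · field_simp
        ring
      · have : (u₁ ^ 2 + v₁ ^ 2 - ((u₁ ^ 2 + v₁ ^ 2) * u₂ + (u₂ ^ 2 + v₂ ^ 2) * u₁) / (u₁ + u₂)) *
            (u₂ ^ 2 + v₂ ^ 2 - ((u₁ ^ 2 + v₁ ^ 2) * u₂ + (u₂ ^ 2 + v₂ ^ 2) * u₁) / (u₁ + u₂)) =
            -(u₁ * u₂ * (u₁ ^ 2 + v₁ ^ 2 - (u₂ ^ 2 + v₂ ^ 2)) ^ 2 / (u₁ + u₂) ^ 2) := by
          field_simp
          ring
        rw [this]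
        exact neg_nonpos.2 (by positivity)
  obtain ⟨γ, hγ⟩ := hX.1 x₁ x₂
  have dleft : ∀ {y : X} {u w v : ℝ} (hv : 0 < v), w ^ 2 = u ^ 2 →
      Real.cosh (dist x₁ y) = (u ^ 2 + v ^ 2 + 1) / (2 * v) →
      dist (point w v hv) (axis 0) = dist x₁ y := by
    intro y u w v hv hw h
    apply eq_of_cosh_eq dist_nonneg dist_nonneg
    rw [cosh_dist_point_axis, h, hw]
    simp
  have dright : ∀ {y : X} {u w v : ℝ} (hv : 0 < v), w ^ 2 = u ^ 2 →
      Real.cosh (dist x₂ y) = (u ^ 2 + v ^ 2 + Real.exp (dist x₁ x₂) ^ 2) /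
        (2 * v * Real.exp (dist x₁ x₂)) →
      dist (point w v hv) (axis (dist x₁ x₂)) = dist x₂ y := by
    intro y u w v hv hw h
    apply eq_of_cosh_eq dist_nonneg dist_nonneg
    rw [cosh_dist_point_axis, h, hw]
  have l₁ := dleft hv₁ (neg_sq u₁) hp₁
  have l₂ := dleft hv₂ rfl hp₂
  have r₁ := dright hv₁ (neg_sq u₁) hq₁
  have r₂ := dright hv₂ rfl hq₂
  have c₁ := hX.dist_le_dist_axis hγ l₁ r₁ ⟨hs0, hsL⟩
  have c₂ := hX.dist_le_dist_axis hγ l₂ r₂ ⟨hs0, hsL⟩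
  -- The glued planar quadrilateral keeps the sides and the diagonal x₁x₂, while the other diagonal
  -- can only grow.
  have hm : dist y₁ y₂ ≤ dist (point (-u₁) v₁ hv₁) (point u₂ v₂ hv₂) :=
    (dist_triangle_right _ _ (γ s)).trans ((add_le_add c₁ c₂).trans
      (dist_add_dist_le_of_crossing hv₁ hv₂ hu₁ hu₂ hs hs'))
  have key := hf.ptolemy (axis 0) (axis (dist x₁ x₂)) (point (-u₁) v₁ hv₁) (point u₂ v₂ hv₂)
  rw [dist_comm (axis 0) (point _ _ _), dist_comm (axis 0) (point _ _ hv₂),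
    dist_comm (axis (dist x₁ x₂)) (point _ _ hv₁), dist_comm (axis (dist x₁ x₂)) (point _ _ hv₂),
    l₁, l₂, r₁, r₂, dist_axis,
    zero_sub, abs_neg, abs_of_pos hL] at key
  exact (mul_le_mul_of_nonneg_left (hf.mono hm) (hf.nonneg _ dist_nonneg)).trans key

end Ptolemy

/-! ### Distances along an equidistant curve -/

section EquidistantCurve

open Real

/-- Half the distance between the projections to a geodesic of two points at distance `2 * w` of
an equidistant curve of it, `c` being the hyperbolic cosine of the distance to the geodesic. -/
noncomputable def halfTranslation (c w : ℝ) : ℝ := arsinh (sinh w / c)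

variable {c : ℝ}

theorem sinh_halfTranslation (c w : ℝ) : sinh (halfTranslation c w) = sinh w / c :=
  sinh_arsinh _

theorem halfTranslation_le_halfTranslation (hc : 0 < c) {v w : ℝ} (h : v ≤ w) :
    halfTranslation c v ≤ halfTranslation c w :=
  arsinh_le_arsinh.2 (by gcongr; exact sinh_le_sinh.2 h)

theorem halfTranslation_nonneg (hc : 0 < c) {w : ℝ} (h : 0 ≤ w) : 0 ≤ halfTranslation c w :=
  arsinh_nonneg_iff.2 (div_nonneg (sinh_nonneg_iff.2 h) hc.le)

theorem halfTranslation_eq {w t : ℝ} (hc : 0 < c) (h : sinh w = c * sinh t) :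
    halfTranslation c w = t := by
  rw [halfTranslation, h, mul_div_cancel_left₀ _ hc.ne', arsinh_sinh]

theorem hasDerivAt_halfTranslation (hc : 0 < c) (w : ℝ) :
    HasDerivAt (halfTranslation c) (cosh w / √(c ^ 2 + sinh w ^ 2)) w := by
  have h := ((hasDerivAt_sinh w).div_const c).arsinh
  refine h.congr_deriv ?_
  have : √(1 + (sinh w / c) ^ 2) = √(c ^ 2 + sinh w ^ 2) / c := by
    rw [← sqrt_sq hc.le, ← sqrt_div (by positivity), sqrt_sq hc.le]
    congr 1
    field_simp
  rw [this, smul_eq_mul]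
  have := sqrt_pos.2 (by positivity : 0 < c ^ 2 + sinh w ^ 2)
  field_simp

/-- This is convexity on [0, ∞): the squared derivative is 1 - (c² - 1)/(c² + sinh² w). -/
theorem halfTranslation_add_sub_le (hc : 1 ≤ c) {x y h : ℝ} (hx : 0 ≤ x) (hxy : x ≤ y)
    (hh : 0 ≤ h) :
    halfTranslation c (x + h) - halfTranslation c x ≤
      halfTranslation c (y + h) - halfTranslation c y := by
  have hc0 : 0 < c := by linarith
  have hd : ∀ w, HasDerivAt (fun w => halfTranslation c (w + h) - halfTranslation c w)
      (cosh (w + h) / √(c ^ 2 + sinh (w + h) ^ 2) - cosh w / √(c ^ 2 + sinh w ^ 2)) w := fun w =>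
    ((hasDerivAt_halfTranslation hc0 (w + h)).comp_add_const w h).sub
      (hasDerivAt_halfTranslation hc0 w)
  refine monotoneOn_of_deriv_nonneg (convex_Ici 0)
    (fun w _ => (hd w).continuousAt.continuousWithinAt)
    (fun w _ => (hd w).differentiableAt.differentiableWithinAt) (fun w hw => ?_)
    (Set.mem_Ici.2 hx) (Set.mem_Ici.2 (hx.trans hxy)) hxy
  rw [interior_Ici, Set.mem_Ioi] at hw
  rw [(hd w).deriv, sub_nonneg, div_le_div_iff₀ (sqrt_pos.2 (by positivity))
    (sqrt_pos.2 (by positivity))]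
  refine (abs_le_of_sq_le_sq' ?_ (by positivity)).2
  rw [mul_pow, mul_pow, sq_sqrt (by positivity), sq_sqrt (by positivity), cosh_sq, cosh_sq]
  have h1 : sinh w ^ 2 ≤ sinh (w + h) ^ 2 :=
    pow_le_pow_left₀ (sinh_nonneg_iff.2 hw.le) (sinh_le_sinh.2 (by linarith)) 2
  have h2 : 1 ≤ c ^ 2 := one_le_pow₀ hc
  linarith [mul_nonneg (sub_nonneg.2 h2) (sub_nonneg.2 h1)]

theorem halfTranslation_sub_le (hc : 1 ≤ c) {x y : ℝ} (hxy : x ≤ y) :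
    halfTranslation c y - halfTranslation c x ≤ y - x := by
  have hc0 : 0 < c := by linarith
  have hd : ∀ w, HasDerivAt (fun w => w - halfTranslation c w)
      (1 - cosh w / √(c ^ 2 + sinh w ^ 2)) w := fun w =>
    (hasDerivAt_id w).sub (hasDerivAt_halfTranslation hc0 w)
  have := monotone_of_deriv_nonneg (fun w => (hd w).differentiableAt) (fun w => by
    rw [(hd w).deriv, sub_nonneg, div_le_one (sqrt_pos.2 (by positivity))]
    refine le_sqrt_of_sq_le ?_
    rw [cosh_sq]
    nlinarith) hxy
  simp only at this
  linarith

/-- Superadditivity of `halfTranslation`, with a defect allowed for large arguments. -/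
theorem halfTranslation_add_le (hc : 1 ≤ c) {a b : ℝ} (ha : 0 ≤ a) (hb : 2 * b ≤ a)
    (hab : halfTranslation c (a - b) = 2 * halfTranslation c (a / 2)) {D₁ D₂ : ℝ}
    (h₁ : a ≤ D₁) (h₂ : a ≤ D₂) :
    halfTranslation c (D₁ / 2) + halfTranslation c (D₂ / 2) ≤
      halfTranslation c ((D₁ + D₂) / 2 - b) := by
  -- Starting from the pair a/2, a/2, where `hab` is equality, convexity enlarges one argument at a
  -- time.
  have e1 := halfTranslation_add_sub_le hc (x := a / 2) (y := D₁ / 2) (h := a / 2 - b)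
    (by linarith) (by linarith) (by linarith)
  have e2 := halfTranslation_add_sub_le hc (x := a / 2) (y := D₂ / 2) (h := D₁ / 2 - b)
    (by linarith) (by linarith) (by linarith)
  rw [show a / 2 + (a / 2 - b) = a - b by ring] at e1
  rw [show a / 2 + (D₁ / 2 - b) = D₁ / 2 + (a / 2 - b) by ring,
    show D₂ / 2 + (D₁ / 2 - b) = (D₁ + D₂) / 2 - b by ring] at e2
  linarith

/-- Propagation of the growth of the distance to a base point, by the Ptolemy inequality. -/
theorem halfTranslation_add_le_of_ptolemy (hc : 0 < c) {p q r D₁ D₂ E w : ℝ} (hq : 0 ≤ q)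
    (hD₁ : 0 < D₁) (hD₂ : 0 ≤ D₂)
    (hpt : sinh (q / 2) * sinh (E / 2) ≤
      sinh (D₁ / 2) * sinh (r / 2) + sinh (p / 2) * sinh (D₂ / 2))
    (hw : w ≤ E / 2)
    (hadd : halfTranslation c (D₁ / 2) + halfTranslation c (D₂ / 2) ≤ halfTranslation c w)
    (hpq : halfTranslation c (p / 2) + halfTranslation c (D₁ / 2) ≤ halfTranslation c (q / 2)) :
    halfTranslation c (q / 2) + halfTranslation c (D₂ / 2) ≤ halfTranslation c (r / 2) := by
  have hE := hadd.trans (halfTranslation_le_halfTranslation hc hw)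
  have sc : ∀ t, sinh t = c * sinh (halfTranslation c t) := fun t => by
    rw [sinh_halfTranslation, mul_div_cancel₀ _ hc.ne']
  have hT := halfTranslation_nonneg hc (by linarith : 0 ≤ q / 2)
  have hB := halfTranslation_nonneg hc (by linarith : 0 ≤ D₂ / 2)
  have hA : 0 < sinh (halfTranslation c (D₁ / 2)) := by
    rw [sinh_halfTranslation]
    exact div_pos (sinh_pos_iff.2 (by linarith)) hc
  rw [sc (q / 2), sc (E / 2), sc (D₁ / 2), sc (r / 2), sc (p / 2), sc (D₂ / 2)] at hpt
  generalize halfTranslation c (q / 2) = T at *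
  generalize halfTranslation c (D₁ / 2) = A at *
  generalize halfTranslation c (D₂ / 2) = B at *
  generalize halfTranslation c (p / 2) = P at *
  generalize halfTranslation c (r / 2) = R at *
  generalize halfTranslation c (E / 2) = F at *
  have h1 : sinh T * sinh F ≤ sinh A * sinh R + sinh P * sinh B := by
    refine le_of_mul_le_mul_left ?_ (by positivity : 0 < c ^ 2)
    linarith
  have h2 : sinh T * sinh (A + B) ≤ sinh T * sinh F :=
    mul_le_mul_of_nonneg_left (sinh_le_sinh.2 hE) (sinh_nonneg_iff.2 hT)
  have h3 : sinh P * sinh B ≤ sinh (T - A) * sinh B :=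
    mul_le_mul_of_nonneg_right (sinh_le_sinh.2 (by linarith)) (sinh_nonneg_iff.2 hB)
  rw [← sinh_le_sinh]
  refine le_of_mul_le_mul_left ?_ hA
  -- Equality in Ptolemy for four points in order on a line, with successive gaps T - A, A, B.
  have h4 : sinh A * sinh (T + B) = sinh T * sinh (A + B) - sinh (T - A) * sinh B := by
    rw [sinh_add, sinh_add, sinh_sub]
    ring
  linarith

end EquidistantCurve

/-! ### Good pairs and the translation number -/

section GoodPairs

open Real

variable {a b : ℝ}

theorem IsGoodPair.pos_left (h : IsGoodPair a b) : 0 < a := by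
  obtain ⟨ha, hb, hab⟩ := h
  refine ha.lt_of_ne fun h => ?_
  subst h
  have := sinh_nonpos_iff.2 (by linarith : 0 - b ≤ 0)
  simp only [zero_div, sinh_zero, mul_zero] at hab
  linarith

theorem IsGoodPair.two_mul_le (h : IsGoodPair a b) : 2 * b ≤ a := by
  have ha := h.pos_left
  have h1 := sinh_pos_iff.2 (half_pos ha)
  have h2 : sinh (a / 2) < sinh (a - b) := by linarith [h.2.2]
  linarith [sinh_lt_sinh.1 h2]

theorem IsGoodPair.one_lt_translationNumber (h : IsGoodPair a b) : 1 < translationNumber a b :=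
  ((eq_translationNumber_iff h _).1 rfl).1

theorem IsGoodPair.cosh_half_log (h : IsGoodPair a b) :
    2 * cosh (log (translationNumber a b) / 2) * sinh (a / 2) = sinh (a - b) := by
  rw [((eq_translationNumber_iff h _).1 rfl).2]
  have := sinh_pos_iff.2 (half_pos h.pos_left)
  field_simp

/-- Because sinh(a - b) + sinh b = 2 sinh(a/2) cosh(a/2 - b), dropping sinh b ≥ 0 gives cosh(log λ /
2) ≤ cosh(a/2 - b). -/
theorem IsGoodPair.log_translationNumber_le (h : IsGoodPair a b) :
    log (translationNumber a b) ≤ a - 2 * b := by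
  have hl := log_pos h.one_lt_translationNumber
  have hs := sinh_pos_iff.2 (half_pos h.pos_left)
  have h1 : cosh (log (translationNumber a b) / 2) ≤ cosh (a / 2 - b) := by
    refine le_of_mul_le_mul_right ?_ (by linarith : 0 < 2 * sinh (a / 2))
    have e1 : sinh (a - b) = sinh (a / 2) * cosh (a / 2 - b) + cosh (a / 2) * sinh (a / 2 - b) := by
      rw [← sinh_add]; congr 1; ring
    have e2 : sinh b = sinh (a / 2) * cosh (a / 2 - b) - cosh (a / 2) * sinh (a / 2 - b) := by
      rw [← sinh_sub]; congr 1; ring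
    have := sinh_nonneg_iff.2 h.2.1
    linarith [h.cosh_half_log]
  rw [cosh_le_cosh, abs_of_pos (half_pos hl), abs_of_nonneg (by linarith [h.two_mul_le])] at h1
  linarith

end GoodPairs

/-! ### Growth along good chains and the tension bound -/

section Chains

open Real

variable {X : Type*} [MetricSpace X]

theorem IsCATNegOne.sinh_half_ptolemy (hX : IsCATNegOne X) (x₁ x₂ y₁ y₂ : X) :
    sinh (dist x₁ x₂ / 2) * sinh (dist y₁ y₂ / 2) ≤
      sinh (dist x₁ y₁ / 2) * sinh (dist x₂ y₂ / 2) +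
        sinh (dist x₁ y₂ / 2) * sinh (dist x₂ y₁ / 2) :=
  UpperHalfPlane.isHyperbolicPtolemaic_sinh_half.catNegOne hX x₁ x₂ y₁ y₂

theorem IsCATNegOne.exp_half_ptolemy (hX : IsCATNegOne X) (x₁ x₂ y₁ y₂ : X) :
    exp (dist x₁ x₂ / 2) * exp (dist y₁ y₂ / 2) ≤
      exp (dist x₁ y₁ / 2) * exp (dist x₂ y₂ / 2) +
        exp (dist x₁ y₂ / 2) * exp (dist x₂ y₁ / 2) :=
  UpperHalfPlane.isHyperbolicPtolemaic_exp_half.catNegOne hX x₁ x₂ y₁ y₂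

theorem IsGoodChain.add_sub_le_dist {a b : ℝ} {n : ℕ} {x : ℕ → X} (hx : IsGoodChain a b n x)
    {j : ℕ} (hj : j + 2 ≤ n) :
    dist (x j) (x (j + 1)) + dist (x (j + 1)) (x (j + 2)) - 2 * b ≤ dist (x j) (x (j + 2)) := by
  have := hx.2 (j + 1) (by omega) hj
  rw [gromovProduct, Nat.add_sub_cancel] at this
  linarith

theorem IsGoodChain.le_dist {a b : ℝ} {n : ℕ} {x : ℕ → X} (hx : IsGoodChain a b n x)
    {j : ℕ} (hj : j + 1 ≤ n) : a ≤ dist (x j) (x (j + 1)) := by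
  rw [dist_comm]
  exact hx.1 j hj

/-- Along a good chain the distance to the initial point grows at least by the translation
length. -/
theorem IsGoodChain.dist_add_log_le {a b : ℝ} {n : ℕ} {x : ℕ → X} (hX : IsCATNegOne X)
    (hab : IsGoodPair a b) (hx : IsGoodChain a b n x) {j : ℕ} (hj : j + 1 ≤ n) :
    dist (x 0) (x j) + log (translationNumber a b) ≤ dist (x 0) (x (j + 1)) := by
  have hl := log_pos hab.one_lt_translationNumber
  have hcosh := hab.cosh_half_log
  have hla := hab.log_translationNumber_le
  generalize log (translationNumber a b) = l at *
  have ha := hab.pos_left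
  have hsl := sinh_pos_iff.2 (half_pos hl)
  -- The equidistant curve on which steps of length `a` advance by `l`; distance 2(a - b) then
  -- advances by 2l.
  obtain ⟨c, hc⟩ : ∃ c, c = sinh (a / 2) / sinh (l / 2) := ⟨_, rfl⟩
  have hca : sinh (a / 2) = c * sinh (l / 2) := by rw [hc, div_mul_cancel₀ _ hsl.ne']
  have hc1 : 1 ≤ c := by
    rw [hc, one_le_div hsl]
    exact sinh_le_sinh.2 (by linarith [hab.2.1])
  have hc0 : 0 < c := by linarith
  have hφ : halfTranslation c (a / 2) = l / 2 := halfTranslation_eq hc0 hca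
  have hφ2 : halfTranslation c (a - b) = 2 * halfTranslation c (a / 2) := by
    rw [hφ]
    apply halfTranslation_eq hc0
    rw [← hcosh, hca, sinh_two_mul]
    ring
  have key : ∀ j, j + 1 ≤ n → halfTranslation c (dist (x 0) (x j) / 2) +
      halfTranslation c (dist (x j) (x (j + 1)) / 2) ≤
        halfTranslation c (dist (x 0) (x (j + 1)) / 2) := by
    intro j
    induction j with
    | zero => simp [halfTranslation]
    | succ j ih =>
      intro hj
      have hd₁ := hx.le_dist (j := j) (by omega)
      have hd₂ := hx.le_dist hj
      have hpt := hX.sinh_half_ptolemy (x (j + 1)) (x 0) (x j) (x (j + 1 + 1))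
      rw [dist_comm (x (j + 1)) (x 0), dist_comm (x (j + 1)) (x j)] at hpt
      refine halfTranslation_add_le_of_ptolemy hc0 dist_nonneg (by linarith) dist_nonneg
        (hpt.trans_eq ?_) (w := (dist (x j) (x (j + 1)) + dist (x (j + 1)) (x (j + 1 + 1))) / 2 - b)
        ?_ (halfTranslation_add_le hc1 ha.le hab.two_mul_le hφ2 hd₁ hd₂) (ih (by omega))
      · ring
      · linarith [hx.add_sub_le_dist hj]
  have h1 := key j hj
  have h2 := halfTranslation_le_halfTranslation hc0
    (by linarith [hx.le_dist hj] : a / 2 ≤ dist (x j) (x (j + 1)) / 2)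
  have h3 : dist (x 0) (x j) / 2 ≤ dist (x 0) (x (j + 1)) / 2 := by
    by_contra! h
    have := halfTranslation_le_halfTranslation hc0 h.le
    linarith
  -- An advance of at least `l` forces the distance itself to grow by `l`, as `halfTranslation c` is
  -- 1-Lipschitz.
  have h4 := halfTranslation_sub_le hc1 h3
  linarith

theorem abs_le_of_abs_exp_sub_one_le {t m : ℝ} (hm : 1 < m) (h₁ : exp t ≤ 1 + 1 / m)
    (h₂ : 1 - 1 / m ≤ exp t) : |t| ≤ 1 / (m - 1) := by
  have hm1 : 0 < m - 1 := by linarith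
  rw [abs_le]
  constructor
  · have h3 : exp (-t) ≤ 1 + 1 / (m - 1) := by
      rw [exp_neg, inv_le_comm₀ (exp_pos t) (by positivity)]
      refine le_trans (le_of_eq ?_) h₂
      field_simp
      ring
    linarith [add_one_le_exp (-t)]
  · have h3 : 1 / m ≤ 1 / (m - 1) := one_div_le_one_div_of_le hm1 (by linarith)
    linarith [add_one_le_exp t]

/-- The tension of four points of a good chain, one of them the initial point. -/
theorem IsGoodChain.abs_four_point_le {a b : ℝ} {n : ℕ} {x : ℕ → X} (hX : IsCATNegOne X)
    (hab : IsGoodPair a b) (hx : IsGoodChain a b n x) {j : ℕ} (hj : j + 2 ≤ n) :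
    |dist (x 0) (x (j + 1)) + dist (x j) (x (j + 2)) - dist (x j) (x (j + 1)) -
      dist (x 0) (x (j + 2))| ≤ 2 / (translationNumber a b - 1) := by
  have hm := hab.one_lt_translationNumber
  have hgrow := hx.dist_add_log_le hX hab (j := j) (by omega)
  have hla := hab.log_translationNumber_le
  have hD := hx.le_dist (j := j) (by omega)
  have hE := hx.add_sub_le_dist hj
  have p1 := hX.exp_half_ptolemy (x (j + 1)) (x 0) (x j) (x (j + 2))
  have p2 := hX.exp_half_ptolemy (x (j + 1)) (x j) (x 0) (x (j + 2))
  rw [dist_comm (x (j + 1)) (x 0), dist_comm (x (j + 1)) (x j), ← exp_add, ← exp_add,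
    ← exp_add] at p1
  rw [dist_comm (x (j + 1)) (x 0), dist_comm (x (j + 1)) (x j), dist_comm (x j) (x 0), ← exp_add,
    ← exp_add, ← exp_add] at p2
  have hm0 : 0 < translationNumber a b := by linarith
  rw [← exp_log hm0]
  rw [← exp_log hm0] at hm
  generalize log (translationNumber a b) = l at *
  generalize dist (x 0) (x (j + 1)) = oy at *
  generalize dist (x j) (x (j + 2)) = xz at *
  generalize dist (x j) (x (j + 1)) = xy at *
  generalize dist (x 0) (x (j + 2)) = oz at *
  generalize dist (x (j + 1)) (x (j + 2)) = yz at *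
  generalize dist (x 0) (x j) = ox at *
  set K := exp (oy / 2 + xz / 2) with hK
  have hK0 : 0 < K := exp_pos _
  have e1 : exp (xy / 2 + oz / 2) = K * exp (-(oy + xz - xy - oz) / 2) := by
    rw [hK, ← exp_add]; congr 1; ring
  -- Growth gives ox ≤ oy - l, and the Gromov product bound gives yz ≤ xz - (a - 2b) ≤ xz - l.
  have e2 : exp (yz / 2 + ox / 2) ≤ K * (1 / exp l) := by
    rw [hK, one_div, ← exp_neg, ← exp_add]
    exact exp_le_exp.2 (by linarith)
  rw [e1] at p1 p2
  have h := abs_le_of_abs_exp_sub_one_le hm (t := -(oy + xz - xy - oz) / 2)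
    (le_of_mul_le_mul_left (by linarith) hK0) (le_of_mul_le_mul_left (by linarith) hK0)
  rw [abs_div, abs_neg, abs_two, div_le_iff₀ two_pos] at h
  refine h.trans_eq ?_
  ring

/-- Appending a point to the chain adds exactly the tension of x₀ with the last three points; three
points have tension 0. -/
theorem tension_eq_sum (x : ℕ → X) (k : ℕ) :
    tension (k + 2) x = ∑ j ∈ Finset.range k, (dist (x 0) (x (j + 2)) +
      dist (x (j + 1)) (x (j + 3)) - dist (x (j + 1)) (x (j + 2)) - dist (x 0) (x (j + 3))) := by
  induction k with
  | zero => simp [tension]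
  | succ k ih =>
    rw [Finset.sum_range_succ, ← ih, tension, tension]
    rw [show k + 1 + 2 - 1 = k + 1 + 1 by omega, show k + 2 - 1 = k + 1 by omega,
      Finset.sum_Icc_succ_top (a := 1) (b := k + 1) (by omega),
      Finset.sum_Icc_succ_top (a := 2) (b := k + 1) (by omega)]
    simp only [Nat.add_sub_cancel]
    simp only [add_assoc, Nat.reduceAdd]
    ring

end Chains

theorem corollary4 {X : Type*} [MetricSpace X] (hX : IsCATNegOne X)
    (a b : ℝ) (hab : IsGoodPair a b) (n : ℕ) (hn : 2 ≤ n) (x : ℕ → X)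
    (hx : IsGoodChain a b n x) :
    |tension n x| ≤ ((n : ℝ) - 2) * (2 / (translationNumber a b - 1)) := by
  obtain ⟨k, rfl⟩ := Nat.exists_eq_add_of_le' hn
  rw [tension_eq_sum]
  refine (Finset.abs_sum_le_sum_abs _ _).trans ((Finset.sum_le_card_nsmul _ _
    (2 / (translationNumber a b - 1)) fun j hj => ?_).trans_eq ?_)
  · exact hx.abs_four_point_le hX hab (j := j + 1) (by have := Finset.mem_range.1 hj; omega)
  · simp
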